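/- A *non-adaptive conditional sampling (NACOND) algorithm* making $m$ queries to an unknown probability distribution $p$ on $[n]=\{1,\dots,n\}$ tosses its internal coins, then submits $m$ nonempty query sets $S_1,\dots,S_m\subseteq[n]$ before seeing any answer, and receives independent answers $x_j\in S_j$, where $x_j=i\in S_j$ with probability $p(i)/p(S_j)$, $p(S)=\sum_{i\in S}p(i)$ (if $p(S_j)=0$, then $x_j$ is uniform on $S_j$); from its coins and the answers it computes a verdict. Let $\mathcal U_n$ be the uniform distribution on $[n]$ and $d_{\mathrm{TV}}(p,q)=\frac12\sum_{i\in[n]}|p(i)-q(i)|$. **Theorem 2 (Non-Adaptive Uniformity Testing).** There is an algorithm which, for all $n\ge 1$ and $\varepsilon>0$, given NACOND access to an unknown distribution $p$ on $[n]$, makes $\tilde O\!\left(\frac{\log n}{\varepsilon^2}\right)$ queries to the oracle on $p$, where explicitly the number of queries is at most $$C\cdot\frac{\log_2 n}{\varepsilon^2}\cdot\log_2(2+\log_2 n)$$ for an absolute constant $C$, and which distinguishes between the cases $p=\mathcal U_n$ and $d_{\mathrm{TV}}(p,\mathcal U_n)\ge\varepsilon$ with probability at least $2/3$: if $p=\mathcal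 U_n$ it answers "uniform" with probability at least $2/3$, and if $d_{\mathrm{TV}}(p,\mathcal U_n)\ge\varepsilon$ it answers "far" with probability at least $2/3$. -/

import Mathlib

/-!
Non-adaptive conditional sampling and testers in that model.  The domain `[n]` is `Fin n`, and a
distribution on `[n]` is a `PMF (Fin n)`.
-/

noncomputable section

namespace CondSampling

/-- Total variation distance, `(1/2) * ∑ i, |p i - q i|`. -/
def dTV {n : ℕ} (p q : PMF (Fin n)) : ℝ :=
  (1 / 2) * ∑ i, |(p i).toReal - (q i).toReal|

/-- A query set: a nonempty subset of `[n]`. -/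
abbrev QuerySet (n : ℕ) : Type := {S : Finset (Fin n) // S.Nonempty}

open Classical in
/-- The law of one answer of the conditional sampling oracle for `p` to the query set `S`:
the symbol `i ∈ S` has probability `p i / p S` if `p S > 0`, and the answer is uniform on `S`
if `p S = 0`. -/
def oracle {n : ℕ} (p : PMF (Fin n)) (S : QuerySet n) : PMF (Fin n) :=
  if h : ∃ i ∈ (S.1 : Set (Fin n)), i ∈ p.support then p.filter (S.1 : Set (Fin n)) h
  else PMF.uniformOfFinset S.1 S.2

/-- The law of a tuple of independent samples, the `j`-th one from `μ j`. -/
def independentSamples {n m : ℕ} (μ : Fin m → PMF (Fin n)) : PMF (Fin m → Fin n) :=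
  PMF.ofFintype (fun a => ∏ j, μ j (a j)) (by
    classical
    rw [← Fintype.prod_sum (fun j i => μ j i)]
    refine Finset.prod_eq_one fun j _ => ?_
    rw [← tsum_fintype (L := SummationFilter.unconditional _)]
    exact (μ j).tsum_coe)

/-- A deterministic non-adaptive tester on `[n]` making `m` queries: all query sets are fixed in
advance, and a verdict is computed from the `m` answers. The verdict `true` stands for
"`p` is uniform" and `false` for "`p` is far from uniform". -/
structure DetTester (n m : ℕ) where
  /-- the query sets, submitted before any answer is seen -/
  query : Fin m → QuerySet n
  /-- the verdict as a function of the answers -/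
  verdict : (Fin m → Fin n) → Bool

/-- The law of the verdict of a deterministic tester when the oracle answers according to `p`,
independently for each query. -/
def DetTester.run {n m : ℕ} (t : DetTester n m) (p : PMF (Fin n)) : PMF Bool :=
  (independentSamples fun j => oracle p (t.query j)).map t.verdict

/-- A randomized non-adaptive tester making `m` queries: the internal coins, tossed independently
of the oracle, select the query sets and the verdict function. -/
abbrev Tester (n m : ℕ) : Type := PMF (DetTester n m)

/-- The law of the verdict of a randomized tester on the unknown distribution `p`, over both the
internal coins and the answers of the oracle. -/
def Tester.run {n m : ℕ} (T : Tester n m) (p : PMF (Fin n)) : PMF Bool :=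
  PMF.bind T fun t => t.run p

end CondSampling

end

open scoped BigOperators ENNReal

namespace CondSampling

open Finset

/-! Each block of the tester picks a random scale k = 2^(j+1) among the L = ⌊log₂ n⌋ dyadic ones,
forms a query set S from k random points, splits S by random bits, and asks T times for a sample
from S. It accepts if the frequency of the half is close to its relative size. The tester accepts if
all 512·L blocks do. Under the uniform distribution the half has exactly its relative size as
probability, so a Chernoff bound and a union-type bound over blocks suffice. If p is ε-far, put x =
n·p, of mean 1, with median m ≤ 2. A dyadic decomposition of 𝔼|x - m| ≥ ε (`half_le_sum_deviation`)
shows that, summed over scales k, the truncated expected numbers of sample points with |x - m| ≥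
εk/4 reach 1/2. At such a scale a second-moment argument (`hitting_probability`) finds, along with a
deviating point, a point across the median, while the total weight of S stays O(k). Thus S contains
two points whose gap is of order ε times the weight of S (`expect_spread`). A random bipartition
turns this gap into a bias of order ε with probability at least 1/2 (`half_le_expect_bias`). A block
therefore rejects with probability of order 1/L, and 512·L blocks detect p. -/

/-! ### Second-moment bound for random samples -/

theorem expect_eval {ι α : Type*} [Fintype ι] [DecidableEq ι] [Fintype α] [Nonempty α]
    (F : α → ℝ) (l : ι) : 𝔼 f : ι → α, F (f l) = 𝔼 a, F a := by
  rw [Fintype.expect_equiv (Equiv.funSplitAt l α) (fun f : ι → α => F (f l))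
    (fun q => F q.1) (fun f => rfl), ← univ_product_univ, expect_product]
  simp

theorem expect_eval₂ {ι α : Type*} [Fintype ι] [DecidableEq ι] [Fintype α] [Nonempty α]
    (F : α → α → ℝ) {l l' : ι} (h : l' ≠ l) :
    𝔼 f : ι → α, F (f l) (f l') = 𝔼 a, 𝔼 b, F a b := by
  rw [Fintype.expect_equiv (Equiv.funSplitAt l α) (fun f : ι → α => F (f l) (f l'))
    (fun q => F q.1 (q.2 ⟨l', h⟩)) (fun f => rfl), ← univ_product_univ, expect_product]
  exact expect_congr rfl fun a _ => expect_eval (F a) _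

theorem expect_sum_sq_le {ι α : Type*} [Fintype ι] [DecidableEq ι] [Fintype α] [Nonempty α]
    (u : α → ℝ) (hu : ∀ a, u a ^ 2 ≤ u a) (K : Finset ι) :
    𝔼 f : ι → α, (∑ l ∈ K, u (f l)) ^ 2 ≤ #K * 𝔼 a, u a + (#K * 𝔼 a, u a) ^ 2 := by
  have hterm : ∀ l ∈ K, ∀ l' ∈ K, 𝔼 f : ι → α, u (f l) * u (f l') ≤
      (if l' = l then 𝔼 a, u a else 0) + (𝔼 a, u a) ^ 2 := by
    intro l _ l' _
    by_cases h : l' = l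
    · subst h
      rw [if_pos rfl, expect_eval (fun a => u a * u a) l']
      have : 𝔼 a, u a * u a ≤ 𝔼 a, u a :=
        expect_le_expect fun a _ => by simpa [sq] using hu a
      nlinarith [sq_nonneg (𝔼 a, u a)]
    · rw [if_neg h, expect_eval₂ (fun a b => u a * u b) h, zero_add, sq,
        Fintype.expect_mul_expect]
  calc 𝔼 f : ι → α, (∑ l ∈ K, u (f l)) ^ 2
      = ∑ l ∈ K, ∑ l' ∈ K, 𝔼 f : ι → α, u (f l) * u (f l') := by
        simp only [← expect_sum_comm]
        exact expect_congr rfl fun f _ => by rw [sq, sum_mul_sum]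
    _ ≤ ∑ l ∈ K, ∑ l' ∈ K, ((if l' = l then 𝔼 a, u a else 0) + (𝔼 a, u a) ^ 2) :=
        sum_le_sum fun l hl => sum_le_sum fun l' hl' => hterm l hl l' hl'
    _ = _ := by
        simp only [sum_add_distrib, sum_ite_eq', sum_const, nsmul_eq_mul]
        rw [sum_congr rfl (fun l hl => if_pos hl)]
        simp only [sum_const, nsmul_eq_mul]
        ring

/-- Here `G` is "deviates from the median" and `P` is "lies on the other side". `E` follows once one
sampled point is good, has a partner, and the remaining sample is not too heavy. Counting such
points and comparing with the count of all good points gives a Paley–Zygmund type bound. -/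
theorem hitting_probability {ι α : Type*} [Fintype ι] [DecidableEq ι] [Fintype α] [Nonempty α]
    (x : α → ℝ) (hx : ∀ a, 0 ≤ x a) (hx1 : 𝔼 a, x a = 1)
    (G : α → Prop) [DecidablePred G] (P : α → α → Prop) [∀ a, DecidablePred (P a)]
    (hP : ∀ a, G a → 1 / 2 ≤ 𝔼 b, if P a b then (1 : ℝ) else 0)
    (K : Finset ι) (hK : 2 ≤ #K) (E : (ι → α) → Prop) [DecidablePred E]
    (hE : ∀ f, ∀ l ∈ K, ∀ l' ∈ K, G (f l) → P (f l) (f l') →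
      ∑ l'' ∈ K.erase l, x (f l'') ≤ 4 * #K → E f)
    (μ : ℝ) (hμ : μ = #K * 𝔼 a, if G a then (1 : ℝ) else 0) :
    μ / (16 * (1 + μ)) ≤ 𝔼 f : ι → α, if E f then (1 : ℝ) else 0 := by
  classical
  set u : α → ℝ := fun a => if G a then (1 : ℝ) else 0 with hu
  set g : ℝ := 𝔼 a, u a with hg
  have hu0 : ∀ a, 0 ≤ u a := fun a => by simp only [hu]; split_ifs <;> norm_num
  have hg0 : 0 ≤ g := expect_nonneg fun a _ => hu0 a
  have hk : (2 : ℝ) ≤ #K := by exact_mod_cast hK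
  have hμ0 : 0 ≤ μ := by rw [hμ]; positivity
  -- The partner index is fixed in advance, so that `f l` and `f (q l)` are independent.
  have hq : ∀ l, ∃ l', l ∈ K → l' ∈ K ∧ l' ≠ l := by
    intro l
    obtain ⟨l', h1, h2⟩ := exists_mem_ne (s := K) (by omega) l
    exact ⟨l', fun _ => ⟨h1, h2⟩⟩
  choose q hq using hq
  set z : (ι → α) → ι → ℝ := fun f l =>
    if G (f l) ∧ P (f l) (f (q l)) ∧ ∑ l'' ∈ K.erase l, x (f l'') ≤ 4 * #K then 1 else 0 with hz
  have hz0 : ∀ f l, 0 ≤ z f l := fun f l => by simp only [hz]; split_ifs <;> norm_num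
  have hzu : ∀ f l, z f l ≤ u (f l) := by
    intro f l
    simp only [hz, hu]
    split_ifs with h1 h2 <;> first | exact absurd h1.1 h2 | norm_num
  -- The partner condition keeps at least g/2. By Markov and independence, excessive weight of the
  -- others costs at most g·(k - 1)/(4k) ≤ g/4, where k = #K.
  have hz1 : ∀ l ∈ K, g / 4 ≤ 𝔼 f, z f l := by
    intro l hl
    obtain ⟨hqK, hql⟩ := hq l hl
    have hpt : ∀ f, u (f l) * (if P (f l) (f (q l)) then 1 else 0)
        - ∑ l'' ∈ K.erase l, (4 * (#K : ℝ))⁻¹ * (u (f l) * x (f l'')) ≤ z f l := by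
      intro f
      rw [← mul_sum, ← mul_sum]
      have hs : 0 ≤ ∑ l'' ∈ K.erase l, x (f l'') := sum_nonneg fun _ _ => hx _
      have hs' : 0 ≤ (4 * (#K : ℝ))⁻¹ * ∑ l'' ∈ K.erase l, x (f l'') := by positivity
      by_cases h1 : G (f l)
      · by_cases h2 : P (f l) (f (q l))
        · by_cases h3 : ∑ l'' ∈ K.erase l, x (f l'') ≤ 4 * #K
          · have h4 : z f l = 1 := if_pos ⟨h1, h2, h3⟩
            simp only [hu, if_pos h1, if_pos h2]
            linarith
          · have h4 : 1 ≤ (4 * (#K : ℝ))⁻¹ * ∑ l'' ∈ K.erase l, x (f l'') := by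
              rw [inv_mul_eq_div, one_le_div (by linarith)]
              exact (not_le.1 h3).le
            have := hz0 f l
            simp only [hu, if_pos h1, if_pos h2]
            linarith
        · have := hz0 f l
          simp only [hu, if_pos h1, if_neg h2]
          linarith
      · have := hz0 f l
        simp only [hu, if_neg h1]
        linarith
    calc g / 4 ≤ g * (1 / 2) - (#K - 1) * ((4 * (#K : ℝ))⁻¹ * g) := by
          have : (#K - 1) * ((4 * (#K : ℝ))⁻¹ * g) = g / 4 * ((#K - 1) / #K) := by
            field_simp
          rw [this]
          have : ((#K : ℝ) - 1) / #K ≤ 1 := by rw [div_le_one (by linarith)]; linarith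
          nlinarith
      _ ≤ 𝔼 f : ι → α, (u (f l) * (if P (f l) (f (q l)) then 1 else 0)
        - ∑ l'' ∈ K.erase l, (4 * (#K : ℝ))⁻¹ * (u (f l) * x (f l''))) := by
          rw [expect_sub_distrib, expect_sum_comm,
            expect_eval₂ (fun a b => u a * (if P a b then 1 else 0)) hql]
          refine sub_le_sub ?_ (le_of_eq ?_)
          · rw [hg, expect_mul]
            refine expect_le_expect fun a _ => ?_
            rw [← mul_expect]
            by_cases ha : G a
            · exact mul_le_mul_of_nonneg_left (hP a ha) (hu0 a)
            · simp [hu, ha]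
          · rw [sum_congr rfl (g := fun _ => (4 * (#K : ℝ))⁻¹ * g)]
            · rw [sum_const, card_erase_of_mem hl, nsmul_eq_mul, Nat.cast_sub (by omega)]
              simp
            · intro l'' hl''
              rw [← mul_expect, expect_eval₂ (fun a b => u a * x b) (ne_of_mem_erase hl''),
                ← Fintype.expect_mul_expect, hx1, mul_one]
      _ ≤ _ := expect_le_expect fun f _ => hpt f
  -- This `t` maximizes the lower bound tμ/2 - t²(μ + μ²) obtained in expectation.
  set t : ℝ := 1 / (4 * (1 + μ)) with ht
  have ht0 : 0 ≤ t := by positivity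
  -- With Z = ∑ z ≤ U = ∑ u, one has 2tZ - t²U² ≤ 1 - (1 - tZ)² ≤ 1, and Z = 0 off `E`.
  have hpt : ∀ f, 2 * t * ∑ l ∈ K, z f l - t ^ 2 * (∑ l ∈ K, u (f l)) ^ 2 ≤
      if E f then (1 : ℝ) else 0 := by
    intro f
    have h1 : (∑ l ∈ K, z f l) ^ 2 ≤ (∑ l ∈ K, u (f l)) ^ 2 :=
      pow_le_pow_left₀ (sum_nonneg fun l _ => hz0 f l) (sum_le_sum fun l _ => hzu f l) 2
    have h1' := mul_le_mul_of_nonneg_left h1 (sq_nonneg t)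
    split_ifs with h
    · nlinarith [sq_nonneg (1 - t * ∑ l ∈ K, z f l)]
    · have : ∑ l ∈ K, z f l = 0 := sum_eq_zero fun l hl => by
        simp only [hz]
        rw [if_neg]
        rintro ⟨h1, h2, h3⟩
        exact h (hE f l hl (q l) (hq l hl).1 h1 h2 h3)
      rw [this]
      nlinarith [sq_nonneg (t * ∑ l ∈ K, u (f l))]
  refine le_trans ?_ (expect_le_expect fun f _ => hpt f)
  rw [expect_sub_distrib, ← mul_expect, ← mul_expect, expect_sum_comm]
  have h2 := expect_sum_sq_le (ι := ι) u (fun a => by simp only [hu]; split_ifs <;> norm_num) K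
  rw [← hg, ← hμ] at h2
  have h3 : μ / 4 ≤ ∑ l ∈ K, 𝔼 f, z f l := by
    calc μ / 4 = ∑ l ∈ K, g / 4 := by rw [sum_const, nsmul_eq_mul, hμ]; ring
      _ ≤ _ := sum_le_sum hz1
  calc μ / (16 * (1 + μ)) = 2 * t * (μ / 4) - t ^ 2 * (μ + μ ^ 2) := by
        rw [ht]; field_simp; ring
    _ ≤ _ := by gcongr

/-! ### Median and dyadic decomposition of the deviation -/

theorem exists_median {α : Type*} [Fintype α] [Nonempty α] (x : α → ℝ) :
    ∃ m : ℝ, 1 / 2 ≤ 𝔼 a, (if x a ≤ m then (1 : ℝ) else 0) ∧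
      1 / 2 ≤ 𝔼 a, (if m ≤ x a then (1 : ℝ) else 0) := by
  classical
  set c : α → ℝ := fun i => 𝔼 a, (if x a ≤ x i then (1 : ℝ) else 0) with hc
  obtain ⟨i, -, hi⟩ := exists_max_image univ x univ_nonempty
  have hne : (univ.filter fun i => 1 / 2 ≤ c i).Nonempty := by
    refine ⟨i, mem_filter.2 ⟨mem_univ _, ?_⟩⟩
    simp only [hc]
    rw [expect_congr rfl (fun a ha => if_pos (hi a ha)), Fintype.expect_const]
    norm_num
  -- The median is the least value whose lower tail has mass at least 1/2. Were its upper tail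
  -- lighter than 1/2, the next smaller value would also qualify.
  obtain ⟨j, hj, hjmin⟩ := exists_min_image _ x hne
  rw [mem_filter] at hj
  refine ⟨x j, hj.2, ?_⟩
  by_contra! hlt
  have hsum : 𝔼 a, (if x j ≤ x a then (1 : ℝ) else 0) + 𝔼 a, (if x a < x j then (1 : ℝ) else 0)
      = 1 := by
    rw [← expect_add_distrib, expect_congr rfl (g := fun _ => (1 : ℝ)), Fintype.expect_const]
    intro a _
    by_cases h : x j ≤ x a
    · simp [h, not_lt.2 h]
    · simp [h, not_le.1 h]
  have hpos : 1 / 2 < 𝔼 a, (if x a < x j then (1 : ℝ) else 0) := by linarith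
  have hne' : (univ.filter fun a => x a < x j).Nonempty := by
    by_contra hemp
    rw [not_nonempty_iff_eq_empty, filter_eq_empty_iff] at hemp
    rw [expect_congr rfl (fun a ha => if_neg (hemp ha)), Fintype.expect_const] at hpos
    norm_num at hpos
  obtain ⟨b, hb, hbmax⟩ := exists_max_image _ x hne'
  rw [mem_filter] at hb
  have : 1 / 2 ≤ c b := by
    refine hpos.le.trans (expect_le_expect fun a _ => ?_)
    by_cases h : x a < x j
    · rw [if_pos h, if_pos (hbmax a (mem_filter.2 ⟨mem_univ _, h⟩))]
    · rw [if_neg h]; split_ifs <;> norm_num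
  exact absurd (hjmin b (mem_filter.2 ⟨mem_univ _, this⟩)) (not_le.2 hb.2)

theorem median_le_two {α : Type*} [Fintype α] [Nonempty α] {x : α → ℝ} (hx : ∀ a, 0 ≤ x a)
    (hx1 : 𝔼 a, x a = 1) {m : ℝ} (hm : 1 / 2 ≤ 𝔼 a, (if m ≤ x a then (1 : ℝ) else 0)) :
    m ≤ 2 := by
  by_contra! h
  have : m * 𝔼 a, (if m ≤ x a then (1 : ℝ) else 0) ≤ 𝔼 a, x a := by
    rw [mul_expect]
    refine expect_le_expect fun a _ => ?_
    split_ifs with h'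
    · linarith
    · simpa using hx a
  nlinarith

theorem expect_abs_sub_one_le {α : Type*} [Fintype α] [Nonempty α] {x : α → ℝ}
    (hx1 : 𝔼 a, x a = 1) (m : ℝ) : 𝔼 a, |x a - 1| ≤ 2 * 𝔼 a, |x a - m| := by
  have h1 : |m - 1| ≤ 𝔼 a, |x a - m| := by
    have : m - 1 = 𝔼 a, (m - x a) := by
      rw [expect_sub_distrib, hx1, Fintype.expect_const]
    rw [this]
    refine (abs_expect_le _ _).trans_eq (expect_congr rfl fun a _ => abs_sub_comm _ _)
  calc 𝔼 a, |x a - 1| ≤ 𝔼 a, (|x a - m| + |m - 1|) :=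
        expect_le_expect fun a _ => abs_sub_le _ _ _
    _ = 𝔼 a, |x a - m| + |m - 1| := by rw [expect_add_distrib, Fintype.expect_const]
    _ ≤ _ := by linarith

/-- The powers of two below a threshold `z` add up to at least `z / 2 - 1`. -/
theorem half_le_sum_two_pow {L : ℕ} {z : ℝ} (hzL : z < 2 ^ (L + 1)) :
    z / 2 - 1 ≤
      ∑ j : Fin L, (2 : ℝ) ^ (j.val + 1) * (if (2 : ℝ) ^ (j.val + 1) ≤ z then 1 else 0) := by
  have hnn : ∀ j ∈ (univ : Finset (Fin L)),
      0 ≤ (2 : ℝ) ^ (j.val + 1) * (if (2 : ℝ) ^ (j.val + 1) ≤ z then 1 else 0) := fun j _ => by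
    split_ifs <;> positivity
  rcases lt_or_ge z 2 with hz | hz
  · exact le_trans (by linarith) (sum_nonneg hnn)
  obtain ⟨r, hr1, hr2⟩ := exists_nat_pow_near (by linarith : 1 ≤ z) (by norm_num : (1 : ℝ) < 2)
  have hr0 : r ≠ 0 := by
    rintro rfl
    norm_num at hr2
    linarith
  have hrL : r < L + 1 := (pow_lt_pow_iff_right₀ (by norm_num : (1 : ℝ) < 2)).1 (hr1.trans_lt hzL)
  obtain ⟨s, rfl⟩ := Nat.exists_eq_succ_of_ne_zero hr0
  refine le_trans ?_ (single_le_sum hnn (mem_univ (⟨s, by omega⟩ : Fin L)))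
  simp only [Nat.succ_eq_add_one] at hr1 hr2 ⊢
  rw [if_pos hr1]
  rw [pow_succ] at hr2
  linarith

/-- Summing 2^j over the dyadic levels below 4h/ε recovers at least 2h/ε - 1 pointwise, which
averages to at least 1. The truncation at 1 and the cutoff at level L need separate treatment. -/
theorem half_le_sum_deviation {n L : ℕ} [NeZero n] (hL : n < 2 ^ (L + 1)) (hL0 : 1 ≤ L)
    (hLn : 2 ^ L ≤ n) (h : Fin n → ℝ) {ε : ℝ} (hε : 0 < ε) (hh : ε ≤ 𝔼 a, h a) :
    1 / 2 ≤ ∑ j : Fin L, min 1 ((2 : ℝ) ^ (j.val + 1) *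
      𝔼 a, if ε / 4 * 2 ^ (j.val + 1) ≤ h a then (1 : ℝ) else 0) := by
  have hE : ∀ j : Fin L, 0 ≤ 𝔼 a, if ε / 4 * 2 ^ (j.val + 1) ≤ h a then (1 : ℝ) else 0 :=
    fun j => expect_nonneg fun a _ => by split_ifs <;> norm_num
  have hnn : ∀ j ∈ (univ : Finset (Fin L)), 0 ≤ min 1 ((2 : ℝ) ^ (j.val + 1) *
      𝔼 a, if ε / 4 * 2 ^ (j.val + 1) ≤ h a then (1 : ℝ) else 0) := fun j _ => by
    have := hE j
    positivity
  have hn : (0 : ℝ) < n := by exact_mod_cast NeZero.pos n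
  by_cases hbig : ∃ a, ε / 4 * n ≤ h a
  -- A single huge value already counts at the top scale: it has mass 1/n, and 2^L ≥ n/2.
  · obtain ⟨a, ha⟩ := hbig
    refine le_trans ?_ (single_le_sum hnn (mem_univ (⟨L - 1, by omega⟩ : Fin L)))
    have e : L - 1 + 1 = L := by omega
    simp only [e]
    refine le_min (by norm_num) ?_
    have h1 : (1 : ℝ) / n ≤ 𝔼 a, if ε / 4 * 2 ^ L ≤ h a then (1 : ℝ) else 0 := by
      rw [Fintype.expect_eq_sum_div_card, Fintype.card_fin]
      gcongr
      refine le_trans ?_ (single_le_sum (fun b _ => ?_) (mem_univ a))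
      · rw [if_pos]
        refine le_trans ?_ ha
        gcongr
        exact_mod_cast hLn
      · split_ifs <;> norm_num
    have h2 : (n : ℝ) ≤ 2 * 2 ^ L := by
      have : n ≤ 2 * 2 ^ L := by rw [pow_succ] at hL; omega
      exact_mod_cast this
    calc (1 : ℝ) / 2 ≤ 2 ^ L * (1 / n) := by
          rw [mul_one_div, div_le_div_iff₀ (by norm_num) hn]
          linarith
      _ ≤ _ := by gcongr
  · push Not at hbig
    by_cases h1 : ∃ j : Fin L, 1 ≤ (2 : ℝ) ^ (j.val + 1) *
        𝔼 a, if ε / 4 * 2 ^ (j.val + 1) ≤ h a then (1 : ℝ) else 0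
    · obtain ⟨j, hj⟩ := h1
      refine le_trans ?_ (single_le_sum hnn (mem_univ j))
      rw [min_eq_left hj]
      norm_num
    · push Not at h1
      rw [sum_congr rfl fun j _ => min_eq_right (h1 j).le]
      simp only [mul_expect]
      rw [← expect_sum_comm]
      calc (1 : ℝ) / 2 ≤ (2 / ε) * 𝔼 a, h a - 1 := by
            have : (2 / ε) * ε ≤ (2 / ε) * 𝔼 a, h a := by gcongr
            rw [div_mul_cancel₀ _ hε.ne'] at this
            linarith
        _ = 𝔼 a, (h a / (ε / 4) / 2 - 1) := by
            rw [expect_sub_distrib, Fintype.expect_const, mul_expect]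
            congr 1
            refine expect_congr rfl fun a _ => ?_
            field_simp
            ring
        _ ≤ _ := by
            refine expect_le_expect fun a _ => ?_
            have hlt : h a / (ε / 4) < 2 ^ (L + 1) := by
              rw [div_lt_iff₀ (by positivity), mul_comm]
              refine (hbig a).trans ?_
              gcongr
              exact_mod_cast hL
            refine (half_le_sum_two_pow hlt).trans (le_of_eq (sum_congr rfl fun j _ => ?_))
            simp only [le_div_iff₀ (show 0 < ε / 4 by positivity), mul_comm (ε / 4)]

/-! ### Random bipartitions -/

/-- Flipping the sign of `v i` moves the sum by 2|v i|, so at least one of the two sums has modulus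
at least |v i|. The flip preserves the uniform law. -/
theorem half_le_expect_sign {α : Type*} [Fintype α] [DecidableEq α] (S : Finset α) (v : α → ℝ)
    {i : α} (hi : i ∈ S) :
    1 / 2 ≤ 𝔼 σ : α → Bool,
      if |v i| ≤ |∑ a ∈ S, if σ a then v a else -v a| then (1 : ℝ) else 0 := by
  set e : (α → Bool) → ℝ := fun σ =>
    if |v i| ≤ |∑ a ∈ S, if σ a then v a else -v a| then (1 : ℝ) else 0 with he
  have hinv : Function.Involutive fun σ : α → Bool => Function.update σ i (!σ i) := by
    intro σ
    simp
  have hflip : 𝔼 σ, e σ = 𝔼 σ, e (Function.update σ i (!σ i)) :=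
    (Fintype.expect_equiv hinv.toPerm _ _ fun σ => rfl).symm
  have hone : ∀ σ, 1 ≤ e σ + e (Function.update σ i (!σ i)) := by
    intro σ
    have h0 : ∀ σ, 0 ≤ e σ := fun σ => by simp only [he]; split_ifs <;> norm_num
    have hrest : (∑ a ∈ S.erase i, if Function.update σ i (!σ i) a then v a else -v a) =
        ∑ a ∈ S.erase i, if σ a then v a else -v a :=
      sum_congr rfl fun a ha => by rw [Function.update_of_ne (ne_of_mem_erase ha)]
    set r := ∑ a ∈ S.erase i, if σ a then v a else -v a with hr
    have hs1 : (∑ a ∈ S, if σ a then v a else -v a) = (if σ i then v i else -v i) + r :=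
      (add_sum_erase S _ hi).symm
    have hs2 : (∑ a ∈ S, if Function.update σ i (!σ i) a then v a else -v a) =
        (if !σ i then v i else -v i) + r := by
      rw [← add_sum_erase S _ hi, hrest, Function.update_self]
    by_cases h1 : |v i| ≤ |∑ a ∈ S, if σ a then v a else -v a|
    · have : e σ = 1 := if_pos h1
      linarith [h0 (Function.update σ i (!σ i))]
    · have : e (Function.update σ i (!σ i)) = 1 := by
        refine if_pos ?_
        rw [hs2]
        rw [hs1] at h1
        have key : |v i + r| < |v i| → |v i| ≤ |-v i + r| := by
          intro h
          have h2 : |v i + (v i)| ≤ |v i + r| + |-v i + r| := by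
            rw [show v i + v i = (v i + r) + -(-v i + r) by ring]
            exact (abs_add_le _ _).trans_eq (by rw [abs_neg])
          rw [← two_mul, abs_mul, abs_two] at h2
          linarith
        have key' : |-v i + r| < |v i| → |v i| ≤ |v i + r| := by
          intro h
          by_contra! h'
          linarith [key h']
        cases hσ : σ i <;> simp only [hσ, Bool.not_false, Bool.not_true, if_true, not_le,
          Bool.false_eq_true, if_false] at h1 ⊢
        · exact key' h1
        · exact key h1
      linarith [h0 σ]
  have : (1 : ℝ) ≤ 𝔼 σ, e σ + 𝔼 σ, e σ := by
    nth_rewrite 2 [hflip]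
    rw [← expect_add_distrib]
    calc (1 : ℝ) = 𝔼 _σ : α → Bool, (1 : ℝ) := (Fintype.expect_const _).symm
      _ ≤ _ := expect_le_expect fun σ _ => hone σ
  linarith

/-- One of the two points is at least γX/2 away from the mean of `x` on `S`. The signed sum of the
centred values is 2X times the bias, so the sign lemma applies. -/
theorem half_le_expect_bias {α : Type*} [Fintype α] [DecidableEq α] (S : Finset α) (x : α → ℝ)
    {γ : ℝ} (hX : 0 < ∑ a ∈ S, x a) {i i' : α} (hi : i ∈ S) (hi' : i' ∈ S)
    (hγ : γ * ∑ a ∈ S, x a ≤ |x i - x i'|) :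
    1 / 2 ≤ 𝔼 σ : α → Bool,
      if γ / 4 ≤ |(∑ a ∈ S with σ a, x a) / (∑ a ∈ S, x a) - #{a ∈ S | σ a} / #S|
      then (1 : ℝ) else 0 := by
  set X := ∑ a ∈ S, x a with hXdef
  set m := X / #S with hm
  have hS : (0 : ℝ) < #S := by exact_mod_cast card_pos.2 ⟨i, hi⟩
  obtain ⟨b, hb, hbγ⟩ : ∃ b ∈ S, γ * X / 2 ≤ |x b - m| := by
    by_contra! h
    have h1 := h i hi
    have h2 := h i' hi'
    have h3 : |x i - x i'| ≤ |x i - m| + |x i' - m| := by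
      rw [abs_sub_comm (x i') m]
      exact abs_sub_le _ _ _
    linarith
  refine (half_le_expect_sign S (fun a => x a - m) hb).trans (expect_le_expect fun σ _ => ?_)
  have hsum0 : ∑ a ∈ S, (x a - m) = 0 := by
    rw [sum_sub_distrib, sum_const, nsmul_eq_mul, hm, mul_div_cancel₀ _ hS.ne', ← hXdef, sub_self]
  have hsigned : (∑ a ∈ S, if σ a then x a - m else -(x a - m)) =
      2 * X * ((∑ a ∈ S with σ a, x a) / X - #{a ∈ S | σ a} / #S) := by
    calc (∑ a ∈ S, if σ a then x a - m else -(x a - m))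
        = ∑ a ∈ S, (2 * (if σ a then x a - m else 0) - (x a - m)) :=
          sum_congr rfl fun a _ => by split_ifs <;> ring
      _ = 2 * (∑ a ∈ S with σ a, x a - #{a ∈ S | σ a} * m) := by
          rw [sum_sub_distrib, hsum0, ← mul_sum, ← sum_filter, sum_sub_distrib, sum_const,
            nsmul_eq_mul, sub_zero]
      _ = _ := by
          rw [hm]
          field_simp
  by_cases h : |x b - m| ≤ |∑ a ∈ S, if σ a then x a - m else -(x a - m)|
  · rw [if_pos h, if_pos]
    rw [hsigned, abs_mul, abs_of_pos (by positivity : 0 < 2 * X)] at h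
    have := hbγ.trans h
    by_contra! hlt
    nlinarith
  · rw [if_neg h]
    split_ifs <;> norm_num

/-! ### Random query sets see a spread -/

/-- The set of the first `k` values of `f`. -/
def valueSet {n : ℕ} (k : ℕ) (f : Fin n → Fin n) : Finset (Fin n) :=
  (univ.filter fun l : Fin n => l.val < k).image f

-- Scale j succeeds with probability at least min(1, ν j)/32. These minima sum to at least 1/2, and
-- averaging over L scales gives 1/(64L).
open Classical in
theorem expect_spread {n L : ℕ} [NeZero n] (hL : n < 2 ^ (L + 1)) (hL0 : 1 ≤ L)
    (hLn : 2 ^ L ≤ n) (x : Fin n → ℝ) (hx : ∀ a, 0 ≤ x a) (hx1 : 𝔼 a, x a = 1)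
    {ε : ℝ} (hε : 0 < ε) (hε1 : ε ≤ 1) (hfar : 2 * ε ≤ 𝔼 a, |x a - 1|) :
    1 / (64 * L) ≤ 𝔼 j : Fin L, 𝔼 f : Fin n → Fin n,
      if 0 < ∑ a ∈ valueSet (2 ^ (j.val + 1)) f, x a ∧
        ∃ i ∈ valueSet (2 ^ (j.val + 1)) f, ∃ i' ∈ valueSet (2 ^ (j.val + 1)) f,
          ε / 40 * ∑ a ∈ valueSet (2 ^ (j.val + 1)) f, x a ≤ |x i - x i'|
      then (1 : ℝ) else 0 := by
  obtain ⟨m, hm1, hm2⟩ := exists_median x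
  have hm := median_le_two hx hx1 hm2
  have hdev := half_le_sum_deviation hL hL0 hLn (fun a => |x a - m|) hε
    (by linarith [expect_abs_sub_one_le hx1 m])
  set ν : Fin L → ℝ := fun j => (2 : ℝ) ^ (j.val + 1) *
      𝔼 a, if ε / 4 * 2 ^ (j.val + 1) ≤ |x a - m| then (1 : ℝ) else 0 with hν
  have hν0 : ∀ j, 0 ≤ ν j := fun j =>
    mul_nonneg (by positivity) (expect_nonneg fun a _ => by split_ifs <;> norm_num)
  have hscale : ∀ j : Fin L, min 1 (ν j) / 32 ≤ 𝔼 f : Fin n → Fin n,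
      if 0 < ∑ a ∈ valueSet (2 ^ (j.val + 1)) f, x a ∧
        ∃ i ∈ valueSet (2 ^ (j.val + 1)) f, ∃ i' ∈ valueSet (2 ^ (j.val + 1)) f,
          ε / 40 * ∑ a ∈ valueSet (2 ^ (j.val + 1)) f, x a ≤ |x i - x i'|
      then (1 : ℝ) else 0 := by
    intro j
    have hk : 2 ^ (j.val + 1) ≤ n := (Nat.pow_le_pow_right (by norm_num) j.2).trans hLn
    have hk2 : 2 ≤ 2 ^ (j.val + 1) := Nat.le_self_pow (by omega) 2
    generalize hkk : 2 ^ (j.val + 1) = k at hk hk2 ⊢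
    have hkk' : (2 : ℝ) ^ (j.val + 1) = k := by exact_mod_cast hkk
    have hcard : #(univ.filter fun l : Fin n => l.val < k) = k := by
      rw [Fin.card_filter_val_lt, min_eq_right hk]
    have hk2' : (2 : ℝ) ≤ k := by exact_mod_cast hk2
    refine le_trans ?_ (hitting_probability x hx hx1 (fun a => ε / 4 * k ≤ |x a - m|)
      (fun a b => if m ≤ x a then x b ≤ m else m ≤ x b) ?_
      (univ.filter fun l : Fin n => l.val < k) (by omega) _ ?_ (ν j) ?_)
    · rw [div_le_div_iff₀ (by norm_num) (by linarith [hν0 j])]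
      have h1 := min_le_left 1 (ν j)
      have h2 := min_le_right 1 (ν j)
      have h3 : min 1 (ν j) * ν j ≤ 1 * ν j := mul_le_mul_of_nonneg_right h1 (hν0 j)
      linarith
    · intro a _
      by_cases ha : m ≤ x a
      · simpa only [if_pos ha] using hm1
      · simpa only [if_neg ha] using hm2
    · intro f l hl l' hl' hG hP hsum
      rw [hcard] at hsum
      have hmem : ∀ l : Fin n, l ∈ (univ.filter fun l : Fin n => l.val < k) →
        f l ∈ valueSet k f := fun l hl => mem_image_of_mem f hl
      have hspread : |x (f l) - m| ≤ |x (f l) - x (f l')| := by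
        split_ifs at hP with h
        · rw [abs_of_nonneg (by linarith), abs_of_nonneg (by linarith)]
          linarith
        · rw [abs_of_nonpos (by linarith), abs_of_nonpos (by linarith)]
          linarith
      have hpos : 0 < |x (f l) - m| := lt_of_lt_of_le (by positivity) hG
      refine ⟨?_, f l, hmem l hl, f l', hmem l' hl', ?_⟩
      · refine (sum_nonneg fun a _ => hx a).lt_of_ne' fun h0 => ?_
        rw [sum_eq_zero_iff_of_nonneg fun a _ => hx a] at h0
        have h1 : x (f l) - x (f l') = 0 := by
          rw [h0 _ (hmem l hl), h0 _ (hmem l' hl'), sub_self]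
        rw [h1, abs_zero] at hspread
        linarith
      · refine le_trans ?_ hspread
        -- Repeated values of `f` are counted once in the set, which only lowers its weight.
        have h1 : ∑ a ∈ valueSet k f, x a ≤ x (f l) + 4 * k := by
          refine (sum_image_le_of_nonneg fun a _ => hx a).trans ?_
          rw [← add_sum_erase _ _ hl]
          linarith
        have h2 : x (f l) ≤ |x (f l) - m| + 2 := by linarith [le_abs_self (x (f l) - m)]
        -- With D = |x (f l) - m|, the weight is at most D + 2 + 4k ≤ D + 5k. Since εk ≤ 4D, the
        -- left side is at most D/40 + D/2.
        calc ε / 40 * ∑ a ∈ valueSet k f, x a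
            ≤ ε / 40 * (|x (f l) - m| + 5 * k) := by gcongr; linarith
          _ ≤ _ := by nlinarith
    · simp only [hν, hcard, hkk']
  calc (1 : ℝ) / (64 * L) = (1 / 2) / 32 / L := by field_simp; norm_num
    _ ≤ (∑ j, min 1 (ν j)) / 32 / L := by gcongr
    _ = 𝔼 j, min 1 (ν j) / 32 := by
        rw [Fintype.expect_eq_sum_div_card, Fintype.card_fin, sum_div]
    _ ≤ _ := expect_le_expect fun j _ => hscale j

/-! ### Chernoff bound for independent samples -/

theorem sum_weight_mul_exp_le {α : Type*} [Fintype α] (w y : α → ℝ) (hw : ∀ a, 0 ≤ w a)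
    (hw1 : ∑ a, w a = 1) (hy : ∀ a, |y a| ≤ 1) (hmean : ∑ a, w a * y a = 0)
    {lam : ℝ} (hlam : |lam| ≤ 1) : ∑ a, w a * Real.exp (lam * y a) ≤ Real.exp (lam ^ 2) := by
  calc ∑ a, w a * Real.exp (lam * y a) ≤ ∑ a, (w a * (1 + lam ^ 2) + lam * (w a * y a)) := by
        refine sum_le_sum fun a _ => ?_
        have h1 : |lam * y a| ≤ 1 := by
          rw [abs_mul]; exact mul_le_one₀ hlam (abs_nonneg _) (hy a)
        have h2 := (abs_le.1 (Real.abs_exp_sub_one_sub_id_le h1)).2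
        have h3 : (lam * y a) ^ 2 ≤ lam ^ 2 := by
          rw [mul_pow]
          have : y a ^ 2 ≤ 1 := (sq_le_one_iff_abs_le_one _).2 (hy a)
          nlinarith [sq_nonneg lam]
        have h4 : Real.exp (lam * y a) ≤ 1 + lam ^ 2 + lam * y a := by linarith
        calc w a * Real.exp (lam * y a) ≤ w a * (1 + lam ^ 2 + lam * y a) :=
              mul_le_mul_of_nonneg_left h4 (hw a)
          _ = _ := by ring
    _ = 1 + lam ^ 2 := by rw [sum_add_distrib, ← sum_mul, ← mul_sum, hw1, hmean]; ring
    _ ≤ _ := by linarith [Real.add_one_le_exp (lam ^ 2)]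

theorem sum_prod_weight_tail_le {α : Type*} [Fintype α] (w y : α → ℝ) (hw : ∀ a, 0 ≤ w a)
    (hw1 : ∑ a, w a = 1) (hy : ∀ a, |y a| ≤ 1) (hmean : ∑ a, w a * y a = 0)
    (T : ℕ) {τ : ℝ} (hτ : 0 ≤ τ) (hτ1 : τ ≤ 1) :
    ∑ a : Fin T → α, (∏ j, w (a j)) * (if T * τ < |∑ j, y (a j)| then 1 else 0) ≤
      2 * Real.exp (-(T * τ ^ 2 / 4)) := by
  have hmgf : ∀ lam : ℝ, |lam| ≤ 1 →
      ∑ a : Fin T → α, (∏ j, w (a j)) * Real.exp (lam * ∑ j, y (a j)) ≤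
        Real.exp (T * lam ^ 2) := by
    intro lam hlam
    calc ∑ a : Fin T → α, (∏ j, w (a j)) * Real.exp (lam * ∑ j, y (a j))
        = ∏ _j : Fin T, ∑ a, w a * Real.exp (lam * y a) := by
          rw [Fintype.prod_sum]
          refine sum_congr rfl fun a _ => ?_
          rw [mul_sum, Real.exp_sum, ← prod_mul_distrib]
      _ = (∑ a, w a * Real.exp (lam * y a)) ^ T := by simp
      _ ≤ Real.exp (lam ^ 2) ^ T :=
          pow_le_pow_left₀ (sum_nonneg fun a _ => mul_nonneg (hw a) (Real.exp_pos _).le)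
            (sum_weight_mul_exp_le w y hw hw1 hy hmean hlam) T
      _ = _ := by rw [← Real.exp_nat_mul]
  -- The parameter λ = τ/2 minimizes the exponent Tλ² - Tλτ, at -Tτ²/4.
  have hp := hmgf (τ / 2) (by rw [abs_of_nonneg (by positivity)]; linarith)
  have hn := hmgf (-(τ / 2)) (by rw [abs_neg, abs_of_nonneg (by positivity)]; linarith)
  have hpt : ∀ s : ℝ, (if T * τ < |s| then (1 : ℝ) else 0) ≤
      Real.exp (-(T * τ ^ 2 / 2)) * (Real.exp (τ / 2 * s) + Real.exp (-(τ / 2) * s)) := by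
    intro s
    rw [mul_add, ← Real.exp_add, ← Real.exp_add]
    split_ifs with h
    · rcases lt_abs.1 h with h | h
      · have : 1 ≤ Real.exp (-(T * τ ^ 2 / 2) + τ / 2 * s) := by
          rw [Real.one_le_exp_iff]; nlinarith
        linarith [Real.exp_pos (-(T * τ ^ 2 / 2) + -(τ / 2) * s)]
      · have : 1 ≤ Real.exp (-(T * τ ^ 2 / 2) + -(τ / 2) * s) := by
          rw [Real.one_le_exp_iff]; nlinarith
        linarith [Real.exp_pos (-(T * τ ^ 2 / 2) + τ / 2 * s)]
    · positivity
  calc _ ≤ ∑ a : Fin T → α, (∏ j, w (a j)) * (Real.exp (-(T * τ ^ 2 / 2)) *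
        (Real.exp (τ / 2 * ∑ j, y (a j)) + Real.exp (-(τ / 2) * ∑ j, y (a j)))) :=
        sum_le_sum fun a _ => mul_le_mul_of_nonneg_left (hpt _) (prod_nonneg fun j _ => hw _)
    _ = Real.exp (-(T * τ ^ 2 / 2)) *
        (∑ a : Fin T → α, (∏ j, w (a j)) * Real.exp (τ / 2 * ∑ j, y (a j)) +
          ∑ a : Fin T → α, (∏ j, w (a j)) * Real.exp (-(τ / 2) * ∑ j, y (a j))) := by
        rw [← sum_add_distrib, mul_sum]
        exact sum_congr rfl fun a _ => by ring
    _ ≤ Real.exp (-(T * τ ^ 2 / 2)) * (Real.exp (T * (τ / 2) ^ 2) +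
          Real.exp (T * (-(τ / 2)) ^ 2)) := by gcongr
    _ = 2 * Real.exp (-(T * τ ^ 2 / 4)) := by
        rw [neg_sq, ← two_mul, mul_left_comm, ← Real.exp_add]
        congr 2
        ring

/-- The empirical frequency of a set of symbols concentrates around its probability. -/
theorem sum_prod_weight_freq_tail_le {α : Type*} [Fintype α] [DecidableEq α] (w : α → ℝ)
    (hw : ∀ a, 0 ≤ w a) (hw1 : ∑ a, w a = 1) (A : Finset α)
    {T : ℕ} (hT : 0 < T) {τ : ℝ} (hτ : 0 ≤ τ) (hτ1 : τ ≤ 1) :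
    ∑ a : Fin T → α, (∏ j, w (a j)) *
      (if τ < |(#{j | a j ∈ A} : ℝ) / T - ∑ i ∈ A, w i| then 1 else 0) ≤
      2 * Real.exp (-(T * τ ^ 2 / 4)) := by
  set q := ∑ i ∈ A, w i with hq
  have hq0 : 0 ≤ q := sum_nonneg fun i _ => hw i
  have hq1 : q ≤ 1 := hw1 ▸ sum_le_univ_sum_of_nonneg hw
  have hmean : ∑ a, w a * ((if a ∈ A then 1 else 0) - q) = 0 := by
    simp only [mul_sub, sum_sub_distrib, ← sum_mul, hw1, mul_ite, mul_one, mul_zero,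
      sum_ite_mem, univ_inter]
    rw [one_mul, ← hq, sub_self]
  refine le_trans (le_of_eq ?_) (sum_prod_weight_tail_le w
    (fun a => (if a ∈ A then 1 else 0) - q) hw hw1 (fun a => ?_) hmean T hτ hτ1)
  · refine sum_congr rfl fun a _ => ?_
    have hT' : (0 : ℝ) < T := by exact_mod_cast hT
    have : ∑ j, ((if a j ∈ A then (1 : ℝ) else 0) - q) = T * ((#{j | a j ∈ A} : ℝ) / T - q) := by
      rw [sum_sub_distrib, sum_boole, sum_const, card_univ, Fintype.card_fin, nsmul_eq_mul]
      field_simp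
    simp only [this, abs_mul, abs_of_pos hT', mul_lt_mul_iff_right₀ hT']
  · rw [abs_le]
    split_ifs <;> constructor <;> linarith

/-! ### Oracle answers and independent blocks -/

theorem sum_pmf_toReal {α : Type*} [Fintype α] (p : PMF α) : ∑ a, (p a).toReal = 1 := by
  rw [← ENNReal.toReal_sum fun a _ => p.apply_ne_top a, ← tsum_fintype (L := SummationFilter.unconditional _),
    p.tsum_coe, ENNReal.toReal_one]

theorem sum_oracle_toReal {n : ℕ} (p : PMF (Fin n)) (S : QuerySet n) {A : Finset (Fin n)}
    (hA : A ⊆ S.1) (hpos : 0 < ∑ i ∈ S.1, (p i).toReal) :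
    ∑ i ∈ A, (oracle p S i).toReal = (∑ i ∈ A, (p i).toReal) / ∑ i ∈ S.1, (p i).toReal := by
  classical
  have h : ∃ i ∈ (S.1 : Set (Fin n)), i ∈ p.support := by
    by_contra! h
    refine hpos.ne' (sum_eq_zero fun i hi => ?_)
    have := h i hi
    rw [PMF.mem_support_iff, not_not] at this
    simp [this]
  have hsum : ∑' a, (S.1 : Set (Fin n)).indicator p a = ∑ i ∈ S.1, p i := by
    rw [tsum_fintype, sum_indicator_subset _ (subset_univ _)]
  rw [sum_div]
  refine sum_congr rfl fun i hi => ?_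
  rw [oracle, dif_pos h, PMF.filter_apply, hsum, Set.indicator_of_mem (mem_coe.2 (hA hi)),
    ENNReal.toReal_mul, ENNReal.toReal_inv, ENNReal.toReal_sum fun a _ => p.apply_ne_top a,
    div_eq_mul_inv]

/-- The tester that submits `N` independent blocks of `T` equal queries, the query set `Q ω` of a
block and its verdict `V ω` depending on a uniform coin `ω`, and accepts if every block does. -/
noncomputable def repeatTester {n : ℕ} {Ω : Type} [Fintype Ω] [Nonempty Ω] (N T : ℕ) (Q : Ω → QuerySet n)
    (V : Ω → (Fin T → Fin n) → Bool) : Tester n (N * T) :=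
  (PMF.uniformOfFintype (Fin N → Ω)).map fun w =>
    { query := fun j => Q (w (finProdFinEquiv.symm j).1)
      verdict := fun a => decide (∀ r, V (w r) (fun s => a (finProdFinEquiv (r, s))) = true) }

theorem independentSamples_map_toReal {n m : ℕ} (μ : Fin m → PMF (Fin n))
    (v : (Fin m → Fin n) → Bool) :
    (((independentSamples μ).map v) true).toReal =
      ∑ a, (∏ j, (μ j (a j)).toReal) * if v a then 1 else 0 := by
  rw [PMF.map_apply, tsum_fintype, ENNReal.toReal_sum]
  · refine sum_congr rfl fun a _ => ?_
    rw [independentSamples, PMF.ofFintype_apply]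
    cases h : v a <;> simp [ENNReal.toReal_prod]
  · intro a _
    split_ifs
    · exact PMF.apply_ne_top _ _
    · exact ENNReal.zero_ne_top

/-- Both coins and answers are independent across blocks, so the acceptance probability is a power
of that of one block. -/
theorem repeatTester_run_true {n : ℕ} {Ω : Type} [Fintype Ω] [Nonempty Ω] (N T : ℕ)
    (Q : Ω → QuerySet n) (V : Ω → (Fin T → Fin n) → Bool) (p : PMF (Fin n)) :
    ((repeatTester N T Q V).run p true).toReal =
      (𝔼 ω, ∑ a : Fin T → Fin n,
        (∏ j, (oracle p (Q ω) (a j)).toReal) * if V ω a then 1 else 0) ^ N := by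
  classical
  have e := expect_pow (univ : Finset Ω) (fun ω => ∑ a : Fin T → Fin n,
        (∏ j, (oracle p (Q ω) (a j)).toReal) * if V ω a then (1 : ℝ) else 0) N
  rw [e, Fintype.piFinset_univ, Tester.run, repeatTester, PMF.bind_map, PMF.bind_apply,
    tsum_fintype, ENNReal.toReal_sum fun a _ => ENNReal.mul_ne_top (PMF.apply_ne_top _ _)
      (PMF.apply_ne_top _ _), Fintype.expect_eq_sum_div_card, sum_div]
  refine sum_congr rfl fun w _ => ?_
  rw [ENNReal.toReal_mul, PMF.uniformOfFintype_apply, ENNReal.toReal_inv, ENNReal.toReal_natCast,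
    mul_comm, ← div_eq_mul_inv, Function.comp_apply, DetTester.run, independentSamples_map_toReal]
  congr 1
  rw [Fintype.prod_sum]
  refine Fintype.sum_equiv
    ((Equiv.arrowCongr finProdFinEquiv.symm (Equiv.refl _)).trans (Equiv.curry _ _ _)) _ _ ?_
  intro a
  change _ = ∏ r, ((∏ s, (oracle p (Q (w r)) (a (finProdFinEquiv (r, s)))).toReal) *
    if V (w r) (fun s => a (finProdFinEquiv (r, s))) then 1 else 0)
  rw [prod_mul_distrib, prod_boole]
  congr 1
  · rw [← Fintype.prod_prod_type'
      (fun r s => (oracle p (Q (w r)) (a (finProdFinEquiv (r, s)))).toReal)]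
    exact (Fintype.prod_equiv finProdFinEquiv _ _ fun x => by simp).symm
  · simp

theorem run_false_toReal {n m : ℕ} (A : Tester n m) (p : PMF (Fin n)) :
    (A.run p false).toReal = 1 - (A.run p true).toReal := by
  have := sum_pmf_toReal (A.run p)
  rw [Fintype.sum_bool] at this
  linarith

theorem two_thirds_le_of_toReal {x : ℝ≥0∞} (hx : x ≠ ∞) (h : 2 / 3 ≤ x.toReal) : 2 / 3 ≤ x := by
  rw [← ENNReal.ofReal_toReal hx]
  refine le_trans (le_of_eq ?_) (ENNReal.ofReal_le_ofReal h)
  rw [ENNReal.ofReal_div_of_pos (by norm_num)]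
  norm_num

/-! ### Analysis of one block -/

theorem valueSet_nonempty {n : ℕ} [NeZero n] {k : ℕ} (hk : 0 < k) (f : Fin n → Fin n) :
    (valueSet k f).Nonempty :=
  ⟨f 0, mem_image_of_mem f (mem_filter.2 ⟨mem_univ _, by simpa using hk⟩)⟩

/-- The coins of one block: a scale, a random map whose first values form the query set, and a
random bipartition. -/
abbrev Coin (n L : ℕ) : Type := Fin L × (Fin n → Fin n) × (Fin n → Bool)

/-- The query set of a block. -/
def coinSet {n L : ℕ} [NeZero n] (ω : Coin n L) : QuerySet n :=
  ⟨valueSet (2 ^ (ω.1.val + 1)) ω.2.1, valueSet_nonempty (by positivity) _⟩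

/-- The half of the query set of a block whose frequency is tested. -/
def coinHalf {n L : ℕ} [NeZero n] (ω : Coin n L) : Finset (Fin n) :=
  {i ∈ (coinSet ω).1 | ω.2.2 i}

/-- The verdict of a block: is the frequency of the half within `τ` of its relative size? -/
noncomputable def coinVerdict {n L T : ℕ} [NeZero n] (τ : ℝ) (ω : Coin n L)
    (a : Fin T → Fin n) : Bool :=
  decide (|(#{j | a j ∈ coinHalf ω} : ℝ) / T - #(coinHalf ω) / #(coinSet ω).1| ≤ τ)

/-- The probability that a block accepts, given its coins. -/
noncomputable def blockAccept {n L : ℕ} [NeZero n] (T : ℕ) (τ : ℝ) (p : PMF (Fin n))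
    (ω : Coin n L) : ℝ :=
  ∑ a : Fin T → Fin n, (∏ j, (oracle p (coinSet ω) (a j)).toReal) *
    if coinVerdict τ ω a then 1 else 0

theorem coinHalf_subset {n L : ℕ} [NeZero n] (ω : Coin n L) : coinHalf ω ⊆ (coinSet ω).1 :=
  filter_subset _ _

theorem sum_prod_oracle {n T : ℕ} (p : PMF (Fin n)) (S : QuerySet n) :
    ∑ a : Fin T → Fin n, ∏ j, (oracle p S (a j)).toReal = 1 := by
  rw [← Fintype.prod_sum (fun (_ : Fin T) i => (oracle p S i).toReal)]
  exact prod_eq_one fun j _ => sum_pmf_toReal _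

theorem blockAccept_nonneg {n L : ℕ} [NeZero n] (T : ℕ) (τ : ℝ) (p : PMF (Fin n))
    (ω : Coin n L) : 0 ≤ blockAccept T τ p ω :=
  sum_nonneg fun a _ => mul_nonneg (prod_nonneg fun j _ => ENNReal.toReal_nonneg)
    (by split_ifs <;> norm_num)

theorem blockAccept_le_one {n L : ℕ} [NeZero n] (T : ℕ) (τ : ℝ) (p : PMF (Fin n))
    (ω : Coin n L) : blockAccept T τ p ω ≤ 1 := by
  rw [← sum_prod_oracle (T := T) p (coinSet ω)]
  refine sum_le_sum fun a _ => mul_le_of_le_one_right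
    (prod_nonneg fun j _ => ENNReal.toReal_nonneg) ?_
  split_ifs <;> norm_num

theorem blockAccept_uniform_ge {n L T : ℕ} [NeZero n] (hT : 0 < T) {τ : ℝ} (hτ : 0 ≤ τ)
    (hτ1 : τ ≤ 1) (ω : Coin n L) :
    1 - 2 * Real.exp (-(T * τ ^ 2 / 4)) ≤
      blockAccept T τ (PMF.uniformOfFintype (Fin n)) ω := by
  set p := PMF.uniformOfFintype (Fin n) with hp
  have hn : (0 : ℝ) < n := by exact_mod_cast NeZero.pos n
  have hsum : ∀ B : Finset (Fin n), ∑ i ∈ B, (p i).toReal = #B * (n : ℝ)⁻¹ := by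
    intro B
    simp [hp]
  have hS : (0 : ℝ) < #(coinSet ω).1 := by exact_mod_cast card_pos.2 (coinSet ω).2
  have hq : ∑ i ∈ coinHalf ω, (oracle p (coinSet ω) i).toReal =
      #(coinHalf ω) / #(coinSet ω).1 := by
    rw [sum_oracle_toReal p _ (coinHalf_subset ω) (by rw [hsum]; positivity), hsum, hsum,
      mul_div_mul_right _ _ (inv_ne_zero hn.ne')]
  have htail := sum_prod_weight_freq_tail_le (fun i => (oracle p (coinSet ω) i).toReal)
    (fun i => ENNReal.toReal_nonneg) (sum_pmf_toReal _) (coinHalf ω) hT hτ hτ1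
  rw [hq] at htail
  have hadd : blockAccept T τ p ω + ∑ a : Fin T → Fin n,
      (∏ j, (oracle p (coinSet ω) (a j)).toReal) *
      (if τ < |(#{j | a j ∈ coinHalf ω} : ℝ) / T - #(coinHalf ω) / #(coinSet ω).1|
        then 1 else 0) = 1 := by
    rw [blockAccept, ← sum_add_distrib]
    refine Eq.trans (sum_congr rfl fun a _ => ?_) (sum_prod_oracle (T := T) p (coinSet ω))
    rw [← mul_add]
    refine mul_right_eq_self₀.2 (Or.inl ?_)
    by_cases h : |(#{j | a j ∈ coinHalf ω} : ℝ) / T - #(coinHalf ω) / #(coinSet ω).1| ≤ τ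
    · simp [coinVerdict, h, not_lt.2 h]
    · simp [coinVerdict, h, not_le.1 h]
  linarith

/-- Acceptance despite a bias above 2τ forces the frequency to be off its true probability by more
than τ. -/
theorem blockAccept_le_of_bias {n L T : ℕ} [NeZero n] (hT : 0 < T) {τ : ℝ} (hτ : 0 ≤ τ)
    (hτ1 : τ ≤ 1) (p : PMF (Fin n)) (ω : Coin n L)
    (hpos : 0 < ∑ i ∈ (coinSet ω).1, (p i).toReal)
    (hbias : 2 * τ < |(∑ i ∈ coinHalf ω, (p i).toReal) / (∑ i ∈ (coinSet ω).1, (p i).toReal) -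
      #(coinHalf ω) / #(coinSet ω).1|) :
    blockAccept T τ p ω ≤ 2 * Real.exp (-(T * τ ^ 2 / 4)) := by
  refine le_trans ?_ (sum_prod_weight_freq_tail_le (fun i => (oracle p (coinSet ω) i).toReal)
    (fun i => ENNReal.toReal_nonneg) (sum_pmf_toReal _) (coinHalf ω) hT hτ hτ1)
  rw [sum_oracle_toReal p _ (coinHalf_subset ω) hpos]
  refine sum_le_sum fun a _ => mul_le_mul_of_nonneg_left ?_
    (prod_nonneg fun j _ => ENNReal.toReal_nonneg)
  by_cases h : |(#{j | a j ∈ coinHalf ω} : ℝ) / T - #(coinHalf ω) / #(coinSet ω).1| ≤ τ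
  · rw [if_pos (c := τ < _)]
    · split_ifs <;> norm_num
    · rw [abs_sub_comm] at hbias
      have := abs_sub_le ((#(coinHalf ω) : ℝ) / #(coinSet ω).1)
        ((#{j | a j ∈ coinHalf ω} : ℝ) / T)
        ((∑ i ∈ coinHalf ω, (p i).toReal) / (∑ i ∈ (coinSet ω).1, (p i).toReal))
      rw [abs_sub_comm ((#(coinHalf ω) : ℝ) / #(coinSet ω).1)
        ((#{j | a j ∈ coinHalf ω} : ℝ) / T)] at this
      linarith
  · rw [if_neg (by simpa [coinVerdict] using h)]
    split_ifs <;> norm_num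

theorem expect_blockAccept_le {n L T : ℕ} [NeZero n] (hL : n < 2 ^ (L + 1)) (hL0 : 1 ≤ L)
    (hLn : 2 ^ L ≤ n) (hT : 0 < T) {ε : ℝ} (hε : 0 < ε) (hε1 : ε ≤ 1) (p : PMF (Fin n))
    (hfar : ε ≤ dTV p (PMF.uniformOfFintype (Fin n)))
    (htail : 2 * Real.exp (-(T * (ε / 400) ^ 2 / 4)) ≤ 1 / 2) :
    𝔼 ω : Coin n L, blockAccept T (ε / 400) p ω ≤ 1 - 1 / (256 * L) := by
  classical
  have hn : (0 : ℝ) < n := by exact_mod_cast NeZero.pos n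
  set x : Fin n → ℝ := fun i => n * (p i).toReal with hxdef
  have hx : ∀ i, 0 ≤ x i := fun i => mul_nonneg hn.le ENNReal.toReal_nonneg
  have hx1 : 𝔼 i, x i = 1 := by
    rw [Fintype.expect_eq_sum_div_card, Fintype.card_fin, ← mul_sum, sum_pmf_toReal, mul_one,
      div_self hn.ne']
  have hfar' : 2 * ε ≤ 𝔼 i, |x i - 1| := by
    have : 𝔼 i, |x i - 1| = ∑ i, |(p i).toReal - (PMF.uniformOfFintype (Fin n) i).toReal| := by
      rw [Fintype.expect_eq_sum_div_card, Fintype.card_fin, sum_div]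
      refine sum_congr rfl fun i _ => ?_
      have : x i - 1 = n * ((p i).toReal - (PMF.uniformOfFintype (Fin n) i).toReal) := by
        simp [hxdef, mul_sub, mul_inv_cancel₀ hn.ne']
      rw [this, abs_mul, abs_of_pos hn, mul_div_cancel_left₀ _ hn.ne']
    rw [this]
    rw [dTV] at hfar
    linarith
  have hspread := expect_spread hL hL0 hLn x hx hx1 hε hε1 hfar'
  set B : Coin n L → ℝ := fun ω =>
    if 0 < ∑ i ∈ (coinSet ω).1, x i ∧ ε / 40 / 4 ≤ |(∑ i ∈ coinHalf ω, x i) /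
      (∑ i ∈ (coinSet ω).1, x i) - #(coinHalf ω) / #(coinSet ω).1| then (1 : ℝ) else 0 with hB
  have hsumx : ∀ A : Finset (Fin n), ∑ i ∈ A, x i = n * ∑ i ∈ A, (p i).toReal := fun A =>
    (mul_sum _ _ _).symm
  have hacc : ∀ ω : Coin n L, blockAccept T (ε / 400) p ω ≤ 1 - 1 / 2 * B ω := by
    intro ω
    simp only [hB]
    split_ifs with h
    · rw [hsumx, hsumx, mul_div_mul_left _ _ hn.ne'] at h
      -- The bias is at least ε/160, beyond twice the threshold, ε/200.
      have := blockAccept_le_of_bias (τ := ε / 400) hT (by positivity) (by linarith) p ω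
        (pos_of_mul_pos_right h.1 hn.le) (lt_of_lt_of_le (by linarith) h.2)
      linarith
    · linarith [blockAccept_le_one T (ε / 400) p ω]
  have hEB : 1 / (128 * (L : ℝ)) ≤ 𝔼 ω, B ω := by
    rw [← univ_product_univ, expect_product]
    calc 1 / (128 * (L : ℝ)) = 1 / 2 * (1 / (64 * L)) := by field_simp; norm_num
      _ ≤ _ := mul_le_mul_of_nonneg_left hspread (by norm_num)
      _ ≤ _ := by
          rw [mul_expect]
          refine expect_le_expect fun j _ => ?_
          rw [← univ_product_univ, expect_product, mul_expect]
          refine expect_le_expect fun f _ => ?_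
          split_ifs with h
          · obtain ⟨hpos, i, hi, i', hi', hii⟩ := h
            rw [mul_one]
            refine (half_le_expect_bias _ x hpos hi hi' hii).trans
              (expect_le_expect fun σ _ => ?_)
            split_ifs with h'
            · exact (if_pos ⟨hpos, h'⟩).ge
            · simp only [hB]
              split_ifs <;> norm_num
          · rw [mul_zero]
            refine expect_nonneg fun σ _ => ?_
            simp only [hB]
            split_ifs <;> norm_num
  have : Nonempty (Fin L) := ⟨⟨0, hL0⟩⟩
  calc 𝔼 ω : Coin n L, blockAccept T (ε / 400) p ω ≤ 𝔼 ω, (1 - 1 / 2 * B ω) :=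
        expect_le_expect fun ω _ => hacc ω
    _ = 1 - 1 / 2 * 𝔼 ω, B ω := by
        rw [expect_sub_distrib, Fintype.expect_const, mul_expect]
    _ ≤ 1 - 1 / 2 * (1 / (128 * (L : ℝ))) := by linarith
    _ = _ := by ring

/-! ### Query count and choice of parameters -/

theorem dTV_le_one {n : ℕ} (p q : PMF (Fin n)) : dTV p q ≤ 1 := by
  have : ∑ i, |(p i).toReal - (q i).toReal| ≤ ∑ i, ((p i).toReal + (q i).toReal) :=
    sum_le_sum fun i _ => abs_sub_le_iff.2
      ⟨by linarith [ENNReal.toReal_nonneg (a := q i), ENNReal.toReal_nonneg (a := p i)],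
       by linarith [ENNReal.toReal_nonneg (a := q i), ENNReal.toReal_nonneg (a := p i)]⟩
  rw [sum_add_distrib, sum_pmf_toReal, sum_pmf_toReal] at this
  rw [dTV]
  linarith

/-- The tester that accepts without making any query. -/
noncomputable def acceptingTester (n : ℕ) : Tester n 0 :=
  PMF.pure ⟨fun j => j.elim0, fun _ => true⟩

theorem acceptingTester_run_true {n : ℕ} (p : PMF (Fin n)) :
    (acceptingTester n).run p true = 1 := by
  rw [Tester.run, acceptingTester, PMF.pure_bind, DetTester.run]
  rw [show (fun _ => true : (Fin 0 → Fin n) → Bool) = Function.const _ true from rfl,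
    PMF.map_const, PMF.pure_apply, if_pos rfl]

theorem query_count_le {L : ℕ} (hL0 : 1 ≤ L) {lg ε : ℝ} (hlg : L ≤ lg) (hε : 0 < ε)
    (hε1 : ε ≤ 1) :
    ((512 * L * ⌈4 * Real.log (6 * (512 * L)) / (ε / 400) ^ 2⌉₊ : ℕ) : ℝ) ≤
      512 * (13 * 640000 + 1) * (lg / ε ^ 2) * Real.logb 2 (2 + lg) := by
  have hL : (1 : ℝ) ≤ L := by exact_mod_cast hL0
  set ℓ := Real.logb 2 (2 + lg) with hℓ
  have h2 : Real.log 2 ≤ 1 := by linarith [Real.log_two_lt_d9]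
  have hℓ1 : 1 ≤ ℓ := by
    rw [hℓ, Real.le_logb_iff_rpow_le (by norm_num) (by linarith), Real.rpow_one]
    linarith
  have hlogL : Real.log L ≤ ℓ := by
    calc Real.log L ≤ Real.log (2 + lg) := Real.log_le_log (by linarith) (by linarith)
      _ ≤ ℓ := by
        rw [hℓ, Real.logb, le_div_iff₀ (Real.log_pos (by norm_num))]
        exact mul_le_of_le_one_right (Real.log_nonneg (by linarith)) h2
  -- 6·512 ≤ 2^12 gives the summand 12, and log L the thirteenth ℓ. The later 640000 is 4·400², and
  -- the 1 pays for the ceiling.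
  have hlog : Real.log (6 * (512 * L)) ≤ 13 * ℓ := by
    calc Real.log (6 * (512 * L)) ≤ Real.log (2 ^ 12 * L) :=
          Real.log_le_log (by linarith) (by linarith)
      _ = 12 * Real.log 2 + Real.log L := by
          rw [Real.log_mul (by norm_num) (by linarith), Real.log_pow]
          norm_num
      _ ≤ _ := by linarith
  have hlog0 : 0 ≤ Real.log (6 * (512 * L)) := Real.log_nonneg (by linarith)
  have hceil := (Nat.ceil_lt_add_one
    (show 0 ≤ 4 * Real.log (6 * (512 * L)) / (ε / 400) ^ 2 by positivity)).le
  have hone : 1 ≤ ℓ / ε ^ 2 := by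
    rw [one_le_div (by positivity)]
    exact (pow_le_one₀ hε.le hε1).trans hℓ1
  have hT : (⌈4 * Real.log (6 * (512 * L)) / (ε / 400) ^ 2⌉₊ : ℝ) ≤
      (13 * 640000 + 1) * (ℓ / ε ^ 2) := by
    calc _ ≤ 4 * Real.log (6 * (512 * L)) / (ε / 400) ^ 2 + 1 := hceil
      _ ≤ 4 * (13 * ℓ) / (ε / 400) ^ 2 + ℓ / ε ^ 2 := by gcongr
      _ = _ := by field_simp; ring
  push_cast
  have hlg0 : 0 ≤ lg := by linarith
  calc _ ≤ 512 * lg * ((13 * 640000 + 1) * (ℓ / ε ^ 2)) := by gcongr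
    _ = _ := by ring

theorem exists_tester (n : ℕ) (ε : ℝ) : ∃ (m : ℕ) (A : Tester n m), ∀ [NeZero n], 0 < ε →
    (m : ℝ) ≤ 512 * (13 * 640000 + 1) * (Real.logb 2 n / ε ^ 2) *
      Real.logb 2 (2 + Real.logb 2 n) ∧
    2 / 3 ≤ A.run (PMF.uniformOfFintype (Fin n)) true ∧
    ∀ p : PMF (Fin n), ε ≤ dTV p (PMF.uniformOfFintype (Fin n)) → 2 / 3 ≤ A.run p false := by
  by_cases hcase : 2 ≤ n ∧ 0 < ε ∧ ε ≤ 1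
  · obtain ⟨hn2, hε, hε1⟩ := hcase
    have : NeZero n := ⟨by omega⟩
    set L := Nat.log 2 n with hLdef
    have hL0 : 1 ≤ L := Nat.log_pos (by norm_num) hn2
    have hLn : 2 ^ L ≤ n := Nat.pow_log_le_self 2 (by omega)
    have hL : n < 2 ^ (L + 1) := Nat.lt_pow_succ_log_self (by norm_num) n
    have hL1 : (1 : ℝ) ≤ L := by exact_mod_cast hL0
    have : Nonempty (Fin L) := ⟨⟨0, hL0⟩⟩
    set T := ⌈4 * Real.log (6 * (512 * L)) / (ε / 400) ^ 2⌉₊ with hTdef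
    have hlog0 : 0 < Real.log (6 * (512 * L)) := Real.log_pos (by linarith)
    have hT : 0 < T := Nat.ceil_pos.2 (by positivity)
    -- `T` is chosen so that a block errs on the uniform distribution with probability at most
    -- 1/(3N), N = 512·L; Bernoulli's inequality then bounds the total error by 1/3.
    have htail : 2 * Real.exp (-(T * (ε / 400) ^ 2 / 4)) ≤ 1 / (3 * (512 * L)) := by
      have h1 : 4 * Real.log (6 * (512 * L)) / (ε / 400) ^ 2 ≤ T := Nat.le_ceil _
      rw [div_le_iff₀ (by positivity)] at h1
      calc 2 * Real.exp (-(T * (ε / 400) ^ 2 / 4))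
          ≤ 2 * Real.exp (-Real.log (6 * (512 * L))) := by gcongr; linarith
        _ = _ := by
          rw [Real.exp_neg, Real.exp_log (by linarith)]
          field_simp
          norm_num
    have htail' : 1 / (3 * (512 * (L : ℝ))) ≤ 1 / 2 :=
      one_div_le_one_div_of_le (by norm_num) (by linarith)
    have hN : ((512 * L : ℕ) : ℝ) = 512 * L := by push_cast; ring
    set A : Tester n (512 * L * T) :=
      repeatTester (512 * L) T (coinSet (n := n) (L := L)) (coinVerdict (ε / 400)) with hA
    have hrun : ∀ p, (A.run p true).toReal =
        (𝔼 ω : Coin n L, blockAccept T (ε / 400) p ω) ^ (512 * L) :=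
      fun p => repeatTester_run_true _ _ _ _ p
    refine ⟨512 * L * T, A, fun {_} _ => ⟨?_, ?_, fun p hp => ?_⟩⟩
    · refine query_count_le hL0 ?_ hε hε1
      rw [Real.le_logb_iff_rpow_le (by norm_num) (by positivity), Real.rpow_natCast]
      exact_mod_cast hLn
    · refine two_thirds_le_of_toReal (PMF.apply_ne_top _ _) ?_
      rw [hrun]
      have hblock : 1 + -(1 / (3 * (512 * (L : ℝ)))) ≤
          𝔼 ω : Coin n L, blockAccept T (ε / 400) (PMF.uniformOfFintype (Fin n)) ω := by
        rw [← Fintype.expect_const (ι := Coin n L) (1 + -(1 / (3 * (512 * (L : ℝ)))))]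
        refine expect_le_expect fun ω _ => ?_
        linarith [blockAccept_uniform_ge hT (by positivity : 0 ≤ ε / 400) (by linarith) ω]
      refine le_trans ?_ (pow_le_pow_left₀ (by linarith) hblock _)
      refine le_trans (le_of_eq ?_) (one_add_mul_le_pow (by linarith) _)
      rw [hN]
      field_simp
      norm_num
    · refine two_thirds_le_of_toReal (PMF.apply_ne_top _ _) ?_
      rw [run_false_toReal, hrun]
      have hblock := expect_blockAccept_le hL hL0 hLn hT hε hε1 p hp (htail.trans htail')
      -- (1 - 1/(256L))^(512L) ≤ e^(-2) ≤ 1/3.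
      have hexp : 𝔼 ω : Coin n L, blockAccept T (ε / 400) p ω ≤
          Real.exp (-(1 / (256 * (L : ℝ)))) :=
        hblock.trans (by linarith [Real.add_one_le_exp (-(1 / (256 * (L : ℝ))))])
      have hpow := pow_le_pow_left₀ (expect_nonneg fun ω _ => blockAccept_nonneg _ _ p ω) hexp
        (512 * L)
      rw [← Real.exp_nat_mul, hN,
        show 512 * (L : ℝ) * -(1 / (256 * (L : ℝ))) = -2 by field_simp; norm_num,
        Real.exp_neg] at hpow
      have h3 : (Real.exp 2)⁻¹ ≤ 3⁻¹ :=
        inv_anti₀ (by norm_num) (by linarith [Real.add_one_le_exp (2 : ℝ)])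
      linarith
  -- For n = 1 the query bound is 0, so no query is allowed. For n = 1 or ε > 1 no distribution is
  -- ε-far, and accepting blindly is correct.
  · refine ⟨0, acceptingTester n, fun {_} hε => ⟨?_, ?_, fun p hp => ?_⟩⟩
    · have hn : (1 : ℝ) ≤ n := by exact_mod_cast NeZero.pos n
      have hlg : 0 ≤ Real.logb 2 n := Real.logb_nonneg (by norm_num) hn
      have : 0 ≤ Real.logb 2 (2 + Real.logb 2 n) := Real.logb_nonneg (by norm_num) (by linarith)
      rw [Nat.cast_zero]
      positivity
    · rw [acceptingTester_run_true]
      exact two_thirds_le_of_toReal ENNReal.one_ne_top (by norm_num)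
    · exfalso
      have hε1 : ε ≤ 1 := hp.trans (dTV_le_one _ _)
      have hn1 : n = 1 := by
        have := NeZero.pos n
        by_contra h
        exact hcase ⟨by omega, hε, hε1⟩
      subst hn1
      have hsub : ∀ q : PMF (Fin 1), (q 0).toReal = 1 := fun q => by
        simpa using sum_pmf_toReal q
      simp [dTV, hsub] at hp
      linarith

end CondSampling

theorem theorem2 :
    ∃ (C : ℝ) (queries : ℕ → ℝ → ℕ)
      (A : ∀ (n : ℕ) (ε : ℝ), CondSampling.Tester n (queries n ε)),
      ∀ (n : ℕ) [NeZero n] (ε : ℝ), 0 < ε →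
        (queries n ε : ℝ) ≤
            C * (Real.logb 2 n / ε ^ 2) * Real.logb 2 (2 + Real.logb 2 n) ∧
        2 / 3 ≤ CondSampling.Tester.run (A n ε) (PMF.uniformOfFintype (Fin n)) true ∧
        ∀ p : PMF (Fin n), ε ≤ CondSampling.dTV p (PMF.uniformOfFintype (Fin n)) →
          2 / 3 ≤ CondSampling.Tester.run (A n ε) p false := by
  choose queries A hA using CondSampling.exists_tester
  exact ⟨512 * (13 * 640000 + 1), queries, A, fun n _ ε hε => hA n ε hε⟩
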